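/- Let $\mathbb F$ be a finite field, $\theta$ an automorphism of $\mathbb F$, and $\mathcal R=\mathbb F[x;\theta]$ the ring of skew polynomials $\sum_i a_i x^i$ with $xa=\theta(a)x$ for $a\in\mathbb F$. For a vector $\mathbf v\in\mathcal R^m$ let $\deg\mathbf v=\max_i\deg v_i$ and, if $\mathbf v\neq 0$, let its leading position be $\mathrm{LP}(\mathbf v)=\max\{i:\deg v_i=\deg\mathbf v\}$, indices running from $0$ to $m-1$. For a shift $\mathbf w\in\mathbb Z_{\ge 0}^m$ put $\Phi_{\mathbf w}(\mathbf v)=(v_0x^{w_0},\dots,v_{m-1}x^{w_{m-1}})$ and $\mathrm{LP}_{\mathbf w}(\mathbf v)=\mathrm{LP}(\Phi_{\mathbf w}(\mathbf v))$. A matrix $V$ over $\mathcal R$ is in $\mathbf w$-shifted weak Popov form if the values $\mathrm{LP}_{\mathbf w}(\mathbf v_i)$ of its nonzero rows $\mathbf v_i$ are pairwise different. Let $\deg\det:\mathcal R^{m\times m}\to\mathbb Z_{\ge0}\cup\{-\infty\}$ be the degree of the Dieudonné determinant, i.e. the unique function with $\deg\det(AA')=\deg\det A+\deg\det A'$, with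 $\deg\det U=0$ for $U\in GL_m(\mathcal R)$, and with $\deg\det\operatorname{diag}(d_0,\dots,d_{m-1})=\sum_i\deg d_i$; it is finite exactly on the matrices of full rank. A simple transformation $i$ on $j$ at position $h$, where $\deg v_{i,h}\le\deg v_{j,h}$, replaces the row $\mathbf v_j$ by $\mathbf v_j-\alpha x^{\beta}\mathbf v_i$ with $\beta=\deg v_{j,h}-\deg v_{i,h}$ and $\alpha=\mathrm{LC}(v_{j,h})/\theta^{\beta}(\mathrm{LC}(v_{i,h}))$, where $\mathrm{LC}$ is the leading coefficient; it is carried out by applying, for every coefficient of $\mathbf v_i$, $\theta^\beta$, a multiplication by $\alpha$, and a subtraction from a coefficient of $\mathbf v_j$. Weak Popov walking takes a shift $\mathbf w\in\mathbb Z_{\ge0}^m$ with $m\ge 1$ and a full-rank matrix $V\in\mathcal R^{m\times m}$ in $\mathbf w$-shifted weak Popov form, and performs the following step towards the shift $\hat{\mathbf w}=\mathbf w+(1,0,\dots,0)$. Let $h_i=\mathrm{LP}_{\mathbf w}(\mathbf v_i)$, and let $i_1,\dots,i_s$ be the indices $i$ with $\mathrm{LP}_{\hat{\mathbf w}}(\mathbf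 v_i)=0$, sorted so that $h_{i_1}<\dots<h_{i_s}$. Set $t=i_1$. For $i=i_2,\dots,i_s$ in this order: if $\deg v_{t,0}\le\deg v_{i,0}$, apply the simple transformation $t$ on $i$ at position $0$; otherwise apply the simple transformation $i$ on $t$ at position $0$ and then set $t=i$. Finally return $V$. The complexity is the total number of arithmetic operations $+,-,\cdot,/$ and $\theta^i$ in $\mathbb F$. **Proposition.** One step of weak Popov walking performs $$O\Big(m\,\deg\det V+\sum_{i<j}|w_i-w_j|+m^2\Big)$$ operations, where the constant in $O(\cdot)$ is absolute, i.e. independent of $\mathbb F$, $\theta$, $m$, $\mathbf w$ and $V$. -/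

import Mathlib

noncomputable section

open scoped Matrix
namespace WeakPopov

/-! ### Degrees of skew polynomials

For a field `F` with an action of `Multiplicative ℕ` by ring endomorphisms (the generator acts by
`θ = SkewPolynomial.φ`), `SkewPolynomial F` is Mathlib's ring of polynomials `∑ aᵢ xⁱ` with
`x a = θ(a) x`.  On a finite field every ring endomorphism is an automorphism. -/

section Degree

variable {F : Type*} [Field F]

/-- The degree of a skew polynomial, with `deg 0 = ⊥` (that is, `-∞`). -/
def deg (p : SkewPolynomial F) : WithBot ℕ := (SkewPolynomial.support p).max

/-- The degree as a natural number (`0` for the zero polynomial). -/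
def natDeg (p : SkewPolynomial F) : ℕ := (SkewPolynomial.support p).sup id

/-- The number of coefficients of `p` in positions `0, …, deg p`: it is `deg p + 1`, and `0` for
the zero polynomial. -/
def len (p : SkewPolynomial F) : ℕ := (SkewPolynomial.support p).sup Nat.succ

/-- The leading coefficient. -/
def leadCoeff (p : SkewPolynomial F) : F := SkewPolynomial.coeff p (natDeg p)

/-- The degree of a vector: the maximal degree of its entries (`⊥` for the zero vector). -/
def vecDeg {m : ℕ} (v : Fin m → SkewPolynomial F) : WithBot ℕ := Finset.univ.sup fun i => deg (v i)

open Classical in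
/-- The leading position of a vector: the largest index of an entry of maximal degree.
The zero vector has no leading position, which is expressed by the value `⊥`. -/
def leadPos {m : ℕ} (v : Fin m → SkewPolynomial F) : WithBot (Fin m) :=
  (Finset.univ.filter fun i => v i ≠ 0 ∧ deg (v i) = vecDeg v).max

/-- Weak Popov form: the leading positions of the nonzero rows are pairwise different. -/
def IsWeakPopov {n m : ℕ} (V : Matrix (Fin n) (Fin m) (SkewPolynomial F)) : Prop :=
  ∀ i j, V i ≠ 0 → V j ≠ 0 → leadPos (V i) = leadPos (V j) → i = j

variable [MulSemiringAction (Multiplicative ℕ) F]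

/-- The shift map `(u₀, …, u_{m-1}) ↦ (u₀ x^{w₀}, …, u_{m-1} x^{w_{m-1}})`. -/
def shiftVec {m : ℕ} (w : Fin m → ℕ) (u : Fin m → SkewPolynomial F) : Fin m → SkewPolynomial F :=
  fun i => u i * SkewPolynomial.X ^ w i

/-- The shift map applied to every row of a matrix. -/
def shiftMat {n m : ℕ} (w : Fin m → ℕ) (V : Matrix (Fin n) (Fin m) (SkewPolynomial F)) :
    Matrix (Fin n) (Fin m) (SkewPolynomial F) :=
  Matrix.of fun i => shiftVec w (V i)

/-- `w`-shifted weak Popov form. -/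
def IsShiftedWeakPopov {n m : ℕ} (w : Fin m → ℕ)
    (V : Matrix (Fin n) (Fin m) (SkewPolynomial F)) : Prop :=
  IsWeakPopov (shiftMat w V)

/-- The `w`-shifted leading position of a vector. -/
def shiftedLeadPos {m : ℕ} (w : Fin m → ℕ) (v : Fin m → SkewPolynomial F) : WithBot (Fin m) :=
  leadPos (shiftVec w v)

end Degree

section Existence

variable {F : Type*} [Field F]

theorem mem_supp {p : SkewPolynomial F} {n : ℕ} :
    n ∈ SkewPolynomial.support p ↔ SkewPolynomial.coeff p n ≠ 0 := SkewPolynomial.mem_support_iff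

theorem coeff_eq_zero_of_natDeg_lt {p : SkewPolynomial F} {n : ℕ} (h : natDeg p < n) :
    SkewPolynomial.coeff p n = 0 := by
  by_contra hc
  exact absurd (Finset.le_sup (f := id) (mem_supp.2 hc)) (by simpa [natDeg] using h)

theorem leadCoeff_ne_zero {p : SkewPolynomial F} (h : p ≠ 0) : leadCoeff p ≠ 0 := by
  have hs : (SkewPolynomial.support p).Nonempty := by
    rw [Finset.nonempty_iff_ne_empty]
    simpa using h
  obtain ⟨n, hn, he⟩ := Finset.exists_mem_eq_sup _ hs id
  have : natDeg p = n := he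
  rw [leadCoeff, this]
  exact mem_supp.1 hn

theorem deg_eq_natDeg {p : SkewPolynomial F} (h : p ≠ 0) : deg p = (natDeg p : WithBot ℕ) := by
  have h1 : natDeg p ∈ SkewPolynomial.support p := mem_supp.2 (leadCoeff_ne_zero h)
  apply le_antisymm
  · apply Finset.max_le
    intro a ha
    exact WithBot.coe_le_coe.2 (Finset.le_sup (f := id) ha)
  · exact Finset.le_max h1

theorem coeff_sub' (p q : SkewPolynomial F) (n : ℕ) : SkewPolynomial.coeff (p - q) n =
    SkewPolynomial.coeff p n - SkewPolynomial.coeff q n := by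
  rw [eq_sub_iff_add_eq, ← SkewPolynomial.coeff_add, sub_add_cancel]

theorem coeff_smul' (c : F) (p : SkewPolynomial F) (n : ℕ) : SkewPolynomial.coeff (c • p) n =
    c * SkewPolynomial.coeff p n := rfl

/-- The coefficient of `x^k`, as an additive map. -/
def coeffHom (k : ℕ) : SkewPolynomial F →+ F where
  toFun p := SkewPolynomial.coeff p k
  map_zero' := rfl
  map_add' a b := SkewPolynomial.coeff_add a b k

/-- Vectors whose `i`-th entry has degree less than `n i`. -/
def boxed {m : ℕ} (n : Fin m → ℕ) : Submodule F (Fin m → SkewPolynomial F) where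
  carrier := {v | ∀ i k, n i ≤ k → SkewPolynomial.coeff (v i) k = 0}
  add_mem' {a b} ha hb i k hk := by
    rw [Pi.add_apply, SkewPolynomial.coeff_add, ha i k hk, hb i k hk, add_zero]
  zero_mem' _ _ _ := rfl
  smul_mem' c v hv i k hk := by
    rw [Pi.smul_apply, coeff_smul', hv i k hk, mul_zero]

/-- A vector of the box is determined by its coefficients. -/
def boxedEquiv {m : ℕ} (n : Fin m → ℕ) :
    (boxed (F := F) n) ≃ₗ[F] ((i : Fin m) → Fin (n i) → F) where
  toFun v i k := SkewPolynomial.coeff (v.1 i) k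
  map_add' u v := by ext i k; exact SkewPolynomial.coeff_add _ _ _
  map_smul' c v := by ext i k; rfl
  invFun f := ⟨fun i => ∑ k : Fin (n i), SkewPolynomial.monomial (k : ℕ) (f i k), by
    intro i k hk
    change SkewPolynomial.coeff (∑ _, _) _ = _
    change coeffHom k (∑ _, _) = 0
    rw [map_sum]
    refine Finset.sum_eq_zero fun j _ => ?_
    change SkewPolynomial.coeff (SkewPolynomial.monomial _ _) k = (0 : F)
    rw [SkewPolynomial.coeff_monomial, if_neg (by have := j.2; omega)]⟩
  left_inv v := by
    ext i k
    change coeffHom k (∑ _, _) = coeffHom k _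
    rw [map_sum]
    change ∑ j : Fin (n i), SkewPolynomial.coeff (SkewPolynomial.monomial _ _) _ =
      SkewPolynomial.coeff _ _
    simp only [SkewPolynomial.coeff_monomial]
    by_cases hk : k < n i
    · rw [Finset.sum_eq_single ⟨k, hk⟩]
      · simp
      · intro b _ hb
        rw [if_neg]
        exact fun h => hb (Fin.ext h)
      · simp
    · rw [v.2 i k (by omega)]
      exact Finset.sum_eq_zero fun j _ => if_neg (by have := j.2; omega)
  right_inv f := by
    ext i k
    change coeffHom k (∑ _, _) = _
    rw [map_sum]
    change ∑ j : Fin (n i), SkewPolynomial.coeff (SkewPolynomial.monomial _ _) _ = _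
    simp only [SkewPolynomial.coeff_monomial]
    rw [Finset.sum_eq_single k]
    · simp
    · intro b _ hb
      rw [if_neg]
      exact fun h => hb (Fin.ext h)
    · simp

instance {m : ℕ} (n : Fin m → ℕ) : Module.Finite F (boxed (F := F) n) :=
  Module.Finite.equiv (boxedEquiv n).symm

theorem finrank_boxed {m : ℕ} (n : Fin m → ℕ) :
    Module.finrank F (boxed (F := F) n) = ∑ i, n i := by
  rw [(boxedEquiv n).finrank_eq, Module.finrank_pi_fintype]
  simp

theorem exists_boxed {m : ℕ} (T : Finset (Fin m → SkewPolynomial F)) :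
    ∃ N : ℕ, ∀ N', N ≤ N' → ∀ v ∈ T, v ∈ boxed (F := F) (fun _ : Fin m => N') := by
  refine ⟨T.sup fun v => Finset.univ.sup fun i => natDeg (v i) + 1, fun N' hN v hv i k hk => ?_⟩
  apply coeff_eq_zero_of_natDeg_lt
  have h1 := Finset.le_sup (f := fun i => natDeg (v i) + 1) (Finset.mem_univ i)
  have h2 := Finset.le_sup (f := fun v : Fin m → SkewPolynomial F =>
    Finset.univ.sup fun i => natDeg (v i) + 1) hv
  beta_reduce at h1 h2 hk
  omega

variable [MulSemiringAction (Multiplicative ℕ) F]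

theorem coeff_mul' (p q : SkewPolynomial F) (n : ℕ) :
    SkewPolynomial.coeff (p * q) n = ∑ x ∈ Finset.HasAntidiagonal.antidiagonal n,
      SkewPolynomial.coeff p x.1 * SkewPolynomial.φ^[x.1] (SkewPolynomial.coeff q x.2) := by
  have := SkewMonoidAlgebra.coeff_mul_antidiagonal_of_finset p q (Multiplicative.ofAdd n)
    ((Finset.HasAntidiagonal.antidiagonal n).map
      ⟨fun x => (Multiplicative.ofAdd x.1, Multiplicative.ofAdd x.2), fun a b h => by simpa [Prod.ext_iff] using h⟩)
    (by
      rintro ⟨a, b⟩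
      simp only [Finset.mem_map, Finset.HasAntidiagonal.mem_antidiagonal]
      constructor
      · rintro ⟨x, hx, h⟩
        cases h
        exact congrArg Multiplicative.ofAdd hx
      · intro h
        exact ⟨(a.toAdd, b.toAdd), congrArg Multiplicative.toAdd h, rfl⟩)
  rw [Finset.sum_map] at this
  simp only [SkewPolynomial.φ_iterate_apply]
  exact this

theorem coeff_monomial_mul (k : ℕ) (c : F) (q : SkewPolynomial F) (n : ℕ) :
    SkewPolynomial.coeff (SkewPolynomial.monomial k c * q) n =
      if k ≤ n then c * SkewPolynomial.φ^[k] (SkewPolynomial.coeff q (n - k)) else 0 := by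
  rw [coeff_mul']
  simp only [SkewPolynomial.coeff_monomial, ite_mul, zero_mul]
  rw [Finset.Nat.sum_antidiagonal_eq_sum_range_succ_mk]
  simp only [Finset.sum_ite_eq, Finset.mem_range, Nat.lt_succ_iff]

theorem iter_ne_zero {a : F} (k : ℕ) (h : a ≠ 0) : SkewPolynomial.φ^[k] a ≠ 0 := by
  have : Function.Injective (SkewPolynomial.φ^[k] : F → F) := (RingHom.injective _).iterate k
  intro h0
  apply h
  apply this
  rw [h0, iterate_map_zero]

theorem coeff_mul_top {p q : SkewPolynomial F} {a b : ℕ}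
    (hp : ∀ k, a < k → SkewPolynomial.coeff p k = 0)
    (hq : ∀ k, b < k → SkewPolynomial.coeff q k = 0) :
    SkewPolynomial.coeff (p * q) (a + b) =
      SkewPolynomial.coeff p a * SkewPolynomial.φ^[a] (SkewPolynomial.coeff q b) := by
  rw [coeff_mul', Finset.sum_eq_single (a, b)]
  · rintro ⟨x, y⟩ hxy hne
    simp only [Finset.HasAntidiagonal.mem_antidiagonal] at hxy
    rcases lt_trichotomy x a with h | h | h
    · rw [hq y (by omega), iterate_map_zero, mul_zero]
    · exact absurd (Prod.ext h (show y = b by omega)) hne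
    · rw [hp x h, zero_mul]
  · simp

theorem coeff_mul_high {p q : SkewPolynomial F} {a b n : ℕ}
    (hp : ∀ k, a ≤ k → SkewPolynomial.coeff p k = 0)
    (hq : ∀ k, b < k → SkewPolynomial.coeff q k = 0) (hn : a + b ≤ n) :
    SkewPolynomial.coeff (p * q) n = 0 := by
  rw [coeff_mul', Finset.sum_eq_zero]
  rintro ⟨x, y⟩ hxy
  simp only [Finset.HasAntidiagonal.mem_antidiagonal] at hxy
  rcases lt_or_ge x a with h | h
  · rw [hq y (by omega), iterate_map_zero, mul_zero]
  · rw [hp x h, zero_mul]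

instance : NoZeroDivisors (SkewPolynomial F) where
  eq_zero_or_eq_zero_of_mul_eq_zero {p q} h := by
    by_contra! hc
    have := coeff_mul_top (p := p) (q := q) (fun k => coeff_eq_zero_of_natDeg_lt)
      (fun k => coeff_eq_zero_of_natDeg_lt)
    rw [h, SkewPolynomial.coeff_zero] at this
    exact mul_ne_zero (leadCoeff_ne_zero hc.1) (iter_ne_zero _ (leadCoeff_ne_zero hc.2)) this.symm

/-- Division with remainder. -/
theorem exists_div {q : SkewPolynomial F} (hq : q ≠ 0) (p : SkewPolynomial F) :
    ∃ a : SkewPolynomial F, ∀ k, natDeg q ≤ k → SkewPolynomial.coeff (p - a * q) k = 0 := by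
  have key : ∀ N (p : SkewPolynomial F), (∀ k, N ≤ k → SkewPolynomial.coeff p k = 0) →
      ∃ a : SkewPolynomial F, ∀ k, natDeg q ≤ k → SkewPolynomial.coeff (p - a * q) k = 0 := by
    intro N
    induction N with
    | zero => exact fun p hp => ⟨0, fun k _ => by simpa using hp k (Nat.zero_le k)⟩
    | succ N ih =>
      intro p hp
      by_cases hN : N < natDeg q
      · exact ⟨0, fun k hk => by simpa using hp k (by omega)⟩
      push Not at hN
      set c := SkewPolynomial.coeff p N / SkewPolynomial.φ^[N - natDeg q] (leadCoeff q) with hc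
      obtain ⟨a, ha⟩ := ih (p - SkewPolynomial.monomial (N - natDeg q) c * q) (by
        intro k hk
        rw [coeff_sub', coeff_monomial_mul, if_pos (by omega)]
        rcases hk.eq_or_lt with rfl | h
        · rw [show N - (N - natDeg q) = natDeg q by omega, hc]
          change _ - _ / _ * SkewPolynomial.φ^[N - natDeg q] (leadCoeff q) = 0
          rw [div_mul_cancel₀ _ (iter_ne_zero _ (leadCoeff_ne_zero hq)), sub_self]
        · rw [hp k (by omega), coeff_eq_zero_of_natDeg_lt (p := q) (by omega), iterate_map_zero]
          simp)
      refine ⟨a + SkewPolynomial.monomial (N - natDeg q) c, fun k hk => ?_⟩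
      rw [add_mul, add_comm, ← sub_sub]
      exact ha k hk
  exact key (natDeg p + 1) p fun k hk => coeff_eq_zero_of_natDeg_lt hk

/-- The map `v ↦ v A`, linear over the base field. -/
def rowMap {m : ℕ} (A : Matrix (Fin m) (Fin m) (SkewPolynomial F)) :
    (Fin m → SkewPolynomial F) →ₗ[F] (Fin m → SkewPolynomial F) :=
  A.vecMulLinear.restrictScalars F

theorem rowMap_mul {m : ℕ} (A B : Matrix (Fin m) (Fin m) (SkewPolynomial F)) :
    rowMap (A * B) = rowMap B ∘ₗ rowMap A := by
  refine LinearMap.ext fun v => ?_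
  exact (Matrix.vecMul_vecMul v A B).symm

theorem exists_shift {m : ℕ} (A : Matrix (Fin m) (Fin m) (SkewPolynomial F)) :
    ∃ K : ℕ, ∀ N, ∀ v ∈ boxed (F := F) (fun _ : Fin m => N),
      rowMap A v ∈ boxed (F := F) (fun _ : Fin m => N + K) := by
  refine ⟨Finset.univ.sup fun i => Finset.univ.sup fun j => natDeg (A i j), ?_⟩
  intro N v hv j k hk
  change SkewPolynomial.coeff (∑ i, v i * A i j) k = 0
  change coeffHom k (∑ _, _) = 0
  rw [map_sum]
  refine Finset.sum_eq_zero fun i _ => ?_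
  refine coeff_mul_high (a := N) (b := natDeg (A i j)) (fun k hk => hv i k hk)
    (fun k => coeff_eq_zero_of_natDeg_lt) ?_
  have h1 := Finset.le_sup (f := fun j => natDeg (A i j)) (Finset.mem_univ j)
  have h2 := Finset.le_sup (f := fun i => Finset.univ.sup fun j => natDeg (A i j))
    (Finset.mem_univ i)
  beta_reduce at h1 h2 hk
  omega

theorem finite_coker {m : ℕ} {A : Matrix (Fin m) (Fin m) (SkewPolynomial F)}
    (hA : Function.Injective (rowMap A)) :
    Module.Finite F ((Fin m → SkewPolynomial F) ⧸ LinearMap.range (rowMap A)) := by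
  classical
  obtain ⟨K, hK⟩ := exists_shift A
  rw [← Module.rank_lt_aleph0_iff]
  refine lt_of_le_of_lt (rank_le (n := m * K) ?_) (Cardinal.natCast_lt_aleph0)
  intro s hs
  let out : ((Fin m → SkewPolynomial F) ⧸ LinearMap.range (rowMap A)) → _ :=
    Function.surjInv (Submodule.mkQ_surjective (LinearMap.range (rowMap A)))
  have hout : ∀ x, (LinearMap.range (rowMap A)).mkQ (out x) = x := Function.surjInv_eq _
  obtain ⟨N, hN⟩ := exists_boxed (s.image out)
  let B := boxed (F := F) (fun _ : Fin m => N + K)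
  let f1 : boxed (F := F) (fun _ : Fin m => N) →ₗ[F] B :=
    ((rowMap A).comp (Submodule.subtype _)).codRestrict B fun v => hK N v.1 v.2
  let e : s → B := fun x => ⟨out x.1, hN _ (by omega) _ (Finset.mem_image_of_mem _ x.2)⟩
  let f2 : (s → F) →ₗ[F] B := Fintype.linearCombination F e
  have hinj : Function.Injective (f1.coprod f2) := by
    rw [← LinearMap.ker_eq_bot, LinearMap.ker_eq_bot']
    rintro ⟨u, c⟩ h
    have h' : rowMap A u.1 + ∑ x, c x • out x.1 = 0 := by
      have := congrArg Subtype.val h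
      rw [LinearMap.coprod_apply] at this
      have h2 : ((f2 c : B) : Fin m → SkewPolynomial F) = ∑ x, c x • out x.1 := by
        simp [f2, e, Fintype.linearCombination_apply]
      rw [← h2]
      exact this
    have hq := congrArg (LinearMap.range (rowMap A)).mkQ h'
    rw [map_add, map_sum, map_zero] at hq
    simp only [map_smul, hout] at hq
    have h0 : (LinearMap.range (rowMap A)).mkQ (rowMap A u.1) = 0 := by
      simp
    rw [h0, zero_add] at hq
    have hc : c = 0 := by
      ext x
      exact Fintype.linearIndependent_iff.1 hs c hq x
    subst hc
    simp only [Pi.zero_apply, zero_smul, Finset.sum_const_zero, add_zero] at h'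
    have hu : u.1 = 0 := hA (by rw [h', map_zero])
    simp [Subtype.ext_iff, hu]
  have := LinearMap.finrank_le_finrank_of_injective hinj
  rw [Module.finrank_prod, finrank_boxed, finrank_boxed] at this
  simp at this
  rw [mul_add] at this
  omega

theorem injective_of_mul {m : ℕ} {A B : Matrix (Fin m) (Fin m) (SkewPolynomial F)}
    (h : Function.Injective (rowMap (A * B))) :
    Function.Injective (rowMap A) ∧ Function.Injective (rowMap B) := by
  rw [rowMap_mul, LinearMap.coe_comp] at h
  have hA : Function.Injective (rowMap A) := h.of_comp
  refine ⟨hA, ?_⟩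
  have := finite_coker hA
  rw [← LinearMap.ker_eq_bot, LinearMap.ker_eq_bot']
  intro u hu
  by_contra hne
  let g : SkewPolynomial F →ₗ[F] ((Fin m → SkewPolynomial F) ⧸ LinearMap.range (rowMap A)) :=
    (LinearMap.range (rowMap A)).mkQ ∘ₗ
      ((LinearMap.toSpanSingleton (SkewPolynomial F) _ u).restrictScalars F)
  have hg : ¬ Function.Injective g := by
    intro hinj
    have hfin := Module.Finite.of_injective g hinj
    have hfin' : Module.Finite F (Multiplicative ℕ →₀ F) :=
      Module.Finite.equiv (SkewMonoidAlgebra.coeffLinearEquiv (S := F) (k := F) (G := Multiplicative ℕ))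
    have := Module.Finite.finite_basis (Finsupp.basisSingleOne (R := F) (ι := Multiplicative ℕ))
    exact not_finite (Multiplicative ℕ)
  rw [← LinearMap.ker_eq_bot, LinearMap.ker_eq_bot'] at hg
  push Not at hg
  obtain ⟨r, hr, hr0⟩ := hg
  have hr' : r • u ∈ LinearMap.range (rowMap A) := (Submodule.Quotient.mk_eq_zero _).1 hr
  obtain ⟨v, hv⟩ := hr'
  have h1 : rowMap B (r • u) = 0 := by
    change B.vecMulLinear (r • u) = 0
    rw [map_smul]
    change r • rowMap B u = 0
    rw [hu, smul_zero]
  have hv0 : v = 0 := h (by simp [hv, h1])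
  rw [hv0, map_zero] at hv
  obtain ⟨i, hi⟩ := Function.ne_iff.1 hne
  exact mul_ne_zero hr0 hi (congrFun hv.symm i)

theorem finrank_coker_mul {m : ℕ} {A B : Matrix (Fin m) (Fin m) (SkewPolynomial F)}
    (hA : Function.Injective (rowMap A)) (hB : Function.Injective (rowMap B)) :
    Module.finrank F ((Fin m → SkewPolynomial F) ⧸ LinearMap.range (rowMap (A * B))) =
    Module.finrank F ((Fin m → SkewPolynomial F) ⧸ LinearMap.range (rowMap A)) +
    Module.finrank F ((Fin m → SkewPolynomial F) ⧸ LinearMap.range (rowMap B)) := by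
  have hAB : Function.Injective (rowMap (A * B)) := by
    rw [rowMap_mul]; exact hB.comp hA
  have := finite_coker hAB
  have hle : LinearMap.range (rowMap (A * B)) ≤ LinearMap.range (rowMap B) := by
    rw [rowMap_mul]; exact LinearMap.range_comp_le_range _ _
  let ψ := Submodule.factor hle
  have hψ : Function.Surjective ψ := Submodule.factor_surjective hle
  have hmap : LinearMap.range (rowMap A) ≤ (LinearMap.range (rowMap (A * B))).comap (rowMap B) := by
    rintro _ ⟨v, rfl⟩
    exact ⟨v, by rw [rowMap_mul]; rfl⟩
  let χ := Submodule.mapQ _ _ (rowMap B) hmap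
  have hχ : Function.Injective χ := by
    rw [← LinearMap.ker_eq_bot, LinearMap.ker_eq_bot']
    intro x
    obtain ⟨v, rfl⟩ := Submodule.mkQ_surjective _ x
    intro hx
    change Submodule.mapQ _ _ (rowMap B) hmap (Submodule.Quotient.mk v) = 0 at hx
    rw [Submodule.mapQ_apply, Submodule.Quotient.mk_eq_zero] at hx
    obtain ⟨z, hz⟩ := hx
    rw [rowMap_mul] at hz
    exact (Submodule.Quotient.mk_eq_zero _).2 ⟨z, hB hz⟩
  have hker : LinearMap.ker ψ = LinearMap.range χ := by
    ext x
    obtain ⟨v, rfl⟩ := Submodule.mkQ_surjective _ x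
    constructor
    · intro hx
      have : Submodule.Quotient.mk v = (0 : _ ⧸ LinearMap.range (rowMap B)) := hx
      rw [Submodule.Quotient.mk_eq_zero] at this
      obtain ⟨z, rfl⟩ := this
      exact ⟨Submodule.Quotient.mk z, rfl⟩
    · rintro ⟨y, hy⟩
      obtain ⟨z, rfl⟩ := Submodule.mkQ_surjective _ y
      rw [← hy]
      change Submodule.Quotient.mk (rowMap B z) = (0 : _ ⧸ LinearMap.range (rowMap B))
      rw [Submodule.Quotient.mk_eq_zero]
      exact ⟨z, rfl⟩
  have h1 := LinearMap.finrank_range_add_finrank_ker ψ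
  rw [LinearMap.range_eq_top.2 hψ, finrank_top, hker, LinearMap.finrank_range_of_inj hχ] at h1
  omega

theorem rowMap_diagonal_apply {m : ℕ} (d v : Fin m → SkewPolynomial F) (i : Fin m) :
    rowMap (Matrix.diagonal d) v i = v i * d i :=
  Matrix.vecMul_diagonal v d i

theorem finrank_coker_diagonal {m : ℕ} (d : Fin m → SkewPolynomial F) (hd : ∀ i, d i ≠ 0) :
    Module.finrank F
      ((Fin m → SkewPolynomial F) ⧸ LinearMap.range (rowMap (Matrix.diagonal d))) =
    ∑ i, natDeg (d i) := by
  have hc : IsCompl (LinearMap.range (rowMap (Matrix.diagonal d)))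
      (boxed (F := F) fun i => natDeg (d i)) := by
    constructor
    · rw [Submodule.disjoint_def]
      rintro _ ⟨v, rfl⟩ h
      ext1 i
      rw [rowMap_diagonal_apply]
      by_cases hv : v i = 0
      · rw [hv, zero_mul]; rfl
      exfalso
      have h1 := h i (natDeg (v i) + natDeg (d i)) (Nat.le_add_left _ _)
      rw [rowMap_diagonal_apply, coeff_mul_top (fun k => coeff_eq_zero_of_natDeg_lt)
        (fun k => coeff_eq_zero_of_natDeg_lt)] at h1
      exact mul_ne_zero (leadCoeff_ne_zero hv) (iter_ne_zero _ (leadCoeff_ne_zero (hd i))) h1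
    · rw [codisjoint_iff, Submodule.eq_top_iff']
      intro v
      choose a ha using fun i => exists_div (hd i) (v i)
      rw [Submodule.mem_sup]
      refine ⟨rowMap (Matrix.diagonal d) a, ⟨a, rfl⟩, fun i => v i - a i * d i, ha, ?_⟩
      ext1 i
      rw [Pi.add_apply, rowMap_diagonal_apply, add_sub_cancel]
  rw [(Submodule.quotientEquivOfIsCompl _ _ hc).finrank_eq, finrank_boxed]

end Existence

section DegDet

/-! ### The determinant degree -/

variable {F : Type*} [Field F] [MulSemiringAction (Multiplicative ℕ) F]

/-- The characterization of the determinant degree (the degree of the Dieudonné determinant):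
it is multiplicative, it vanishes on invertible matrices, and its value at a diagonal matrix is
the sum of the degrees of the diagonal entries. -/
def IsDegDet {m : ℕ} (D : Matrix (Fin m) (Fin m) (SkewPolynomial F) → WithBot ℕ) : Prop :=
  (∀ A A', D (A * A') = D A + D A') ∧ (∀ U, IsUnit U → D U = 0) ∧
    ∀ d : Fin m → SkewPolynomial F, D (Matrix.diagonal d) = ∑ i, deg (d i)

open Classical in
theorem exists_isDegDet (F : Type*) [Field F] [MulSemiringAction (Multiplicative ℕ) F] (m : ℕ) :
    ∃ D : Matrix (Fin m) (Fin m) (SkewPolynomial F) → WithBot ℕ, IsDegDet D := by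
  refine ⟨fun A => if Function.Injective (rowMap A) then
    ((Module.finrank F ((Fin m → SkewPolynomial F) ⧸ LinearMap.range (rowMap A)) : ℕ) :
      WithBot ℕ) else ⊥, ?_, ?_, ?_⟩
  · intro A B
    by_cases h : Function.Injective (rowMap (A * B))
    · have hAB := injective_of_mul h
      simp only [if_pos h, if_pos hAB.1, if_pos hAB.2, finrank_coker_mul hAB.1 hAB.2]
      rfl
    · simp only [if_neg h]
      by_cases hA : Function.Injective (rowMap A)
      · by_cases hB : Function.Injective (rowMap B)
        · exact absurd (by rw [rowMap_mul]; exact hB.comp hA) h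
        · simp only [if_neg hB, WithBot.add_bot]
      · simp only [if_neg hA, WithBot.bot_add]
  · intro U hU
    obtain ⟨W, h1, h2⟩ := isUnit_iff_exists.1 hU
    have e1 : ∀ v, rowMap W (rowMap U v) = v := fun v => by
      rw [← LinearMap.comp_apply, ← rowMap_mul, h1]; exact Matrix.vecMul_one v
    have e2 : ∀ v, rowMap U (rowMap W v) = v := fun v => by
      rw [← LinearMap.comp_apply, ← rowMap_mul, h2]; exact Matrix.vecMul_one v
    have hinj : Function.Injective (rowMap U) := Function.LeftInverse.injective e1
    have htop : LinearMap.range (rowMap U) = ⊤ :=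
      LinearMap.range_eq_top.2 (Function.RightInverse.surjective e2)
    have h0 : Module.finrank F
        ((Fin m → SkewPolynomial F) ⧸ LinearMap.range (rowMap U)) = 0 := by
      rw [htop]
      exact Module.finrank_zero_of_subsingleton
    simp only [if_pos hinj, h0]
    rfl
  · intro d
    by_cases hd : ∀ i, d i ≠ 0
    · have hinj : Function.Injective (rowMap (Matrix.diagonal d)) := by
        rw [← LinearMap.ker_eq_bot, LinearMap.ker_eq_bot']
        intro v hv
        ext1 i
        have := congrFun hv i
        rw [rowMap_diagonal_apply] at this
        exact (mul_eq_zero.1 this).resolve_right (hd i)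
      simp only [if_pos hinj, finrank_coker_diagonal d hd, deg_eq_natDeg (hd _)]
      push_cast
      rfl
    · push Not at hd
      obtain ⟨i, hi⟩ := hd
      have hinj : ¬ Function.Injective (rowMap (Matrix.diagonal d)) := by
        intro h
        have h0 : rowMap (Matrix.diagonal d) (Pi.single i 1) = 0 := by
          ext1 j
          rw [rowMap_diagonal_apply]
          by_cases hj : j = i
          · subst hj; rw [hi, mul_zero]; rfl
          · rw [Pi.single_eq_of_ne hj, zero_mul]; rfl
        have := congrFun (h (h0.trans (map_zero _).symm)) i
        rw [Pi.single_eq_same] at this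
        have h1 := congrArg (fun p => SkewPolynomial.coeff p 0) this
        exact one_ne_zero (SkewPolynomial.coeff_one_zero.symm.trans h1)
      have hbot : deg (d i) = ⊥ := by rw [hi]; rfl
      simp only [if_neg hinj]
      rw [← Finset.add_sum_erase _ _ (Finset.mem_univ i), hbot, WithBot.bot_add]

/-- The determinant degree of a square matrix over the skew polynomial ring, with values in
`ℕ ∪ {-∞}`: the function that is characterized by `IsDegDet`. -/
def degDet {m : ℕ} : Matrix (Fin m) (Fin m) (SkewPolynomial F) → WithBot ℕ :=
  Classical.choose (exists_isDegDet F m)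

end DegDet

/-! ### Computations that count field operations -/

/-- A computation with result `val` that has performed `ops` arithmetic operations in the
base field. -/
structure Counted (α : Type*) where
  /-- the result -/
  val : α
  /-- the number of field operations performed -/
  ops : ℕ

namespace Counted

/-- A result that costs no field operation. -/
protected def pure {α : Type*} (a : α) : Counted α := ⟨a, 0⟩

/-- Sequential composition: the operation counts add up. -/
protected def bind {α β : Type*} (c : Counted α) (f : α → Counted β) : Counted β :=
  ⟨(f c.val).val, c.ops + (f c.val).ops⟩

instance : Monad Counted where
  pure := Counted.pure
  bind := Counted.bind

instance : LawfulMonad Counted :=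
  LawfulMonad.mk' (m := Counted)
    (id_map := fun x => by cases x; rfl)
    (pure_bind := fun x f => by
      simp only [bind, pure, Counted.bind, Counted.pure, Nat.zero_add])
    (bind_assoc := fun x f g => by
      simp only [bind, Counted.bind, Nat.add_assoc])

/-- Run one computation for every index in `Fin m` and collect the results. -/
def forAll {m : ℕ} {α : Type*} (f : Fin m → Counted α) : Counted (Fin m → α) :=
  ⟨fun c => (f c).val, ∑ c, (f c).ops⟩

variable {F : Type*} [Field F]

/-- One subtraction in the field. -/
def sub (a b : F) : Counted F := ⟨a - b, 1⟩

/-- One multiplication in the field. -/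
def mul (a b : F) : Counted F := ⟨a * b, 1⟩

/-- One division in the field. -/
def div (a b : F) : Counted F := ⟨a / b, 1⟩

/-- One application of a power `θ^i` of the automorphism. -/
def theta [MulSemiringAction (Multiplicative ℕ) F] (i : ℕ) (a : F) : Counted F :=
  ⟨SkewPolynomial.φ^[i] a, 1⟩

end Counted

section Algorithm

/-! ### Weak Popov walking

Every value of the field that the algorithm computes is produced by one of the counted operations
above.  As usual in the count of arithmetic operations, inspecting degrees, comparing and sorting
integers, and moving data are free. -/

variable {F : Type*} [Field F]

variable [MulSemiringAction (Multiplicative ℕ) F]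

/-- Compute `q - α x^β p`, coefficient by coefficient: for every coefficient of `p`, apply `θ^β`,
multiply by `α`, and subtract the result from a coefficient of `q`. -/
def subScaled (α : F) (β : ℕ) (p q : SkewPolynomial F) : Counted (SkewPolynomial F) :=
  (List.range (len p)).foldlM (fun r k => do
    let a ← Counted.theta β (SkewPolynomial.coeff p k)
    let b ← Counted.mul α a
    let c ← Counted.sub (SkewPolynomial.coeff r (k + β)) b
    pure (SkewPolynomial.update r (k + β) c)) q

/-- The loop in `subScaled` computes `q - α x^β p`. -/
theorem subScaled_val (α : F) (β : ℕ) (p q : SkewPolynomial F) :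
    (subScaled α β p q).val = q - SkewPolynomial.monomial β α * p := by
  have hlen : ∀ k, len p ≤ k → SkewPolynomial.coeff p k = 0 := by
    intro k hk
    by_contra hc
    have : k + 1 ≤ len p := Finset.le_sup (f := Nat.succ) (mem_supp.2 hc)
    omega
  have key : ∀ n k, SkewPolynomial.coeff ((List.range n).foldlM (m := Counted) (fun r k => do
      let a ← Counted.theta β (SkewPolynomial.coeff p k)
      let b ← Counted.mul α a
      let c ← Counted.sub (SkewPolynomial.coeff r (k + β)) b
      pure (SkewPolynomial.update r (k + β) c)) q).val k = SkewPolynomial.coeff q k -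
        if β ≤ k ∧ k - β < n then
          α * SkewPolynomial.φ^[β] (SkewPolynomial.coeff p (k - β)) else 0 := by
    intro n
    induction n with
    | zero => intro k; simp [pure, Counted.pure]
    | succ n ih =>
      intro k
      rw [List.range_succ, List.foldlM_append]
      simp only [List.foldlM_cons, List.foldlM_nil, bind, Counted.bind, pure, Counted.pure,
        Counted.theta, Counted.mul, Counted.sub] at ih ⊢
      rw [SkewPolynomial.coeff_update, Function.update_apply]
      by_cases hk : k = n + β
      · subst hk
        rw [if_pos rfl, ih, if_neg (by omega), if_pos (by omega), Nat.add_sub_cancel, sub_zero]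
      · rw [if_neg hk, ih]
        congr 1
        exact if_congr (by omega) rfl rfl
  refine SkewPolynomial.ext fun k => ?_
  rw [coeff_sub', coeff_monomial_mul, subScaled, key]
  congr 1
  by_cases h1 : β ≤ k
  · by_cases h2 : k - β < len p
    · rw [if_pos ⟨h1, h2⟩, if_pos h1]
    · rw [if_neg (fun h => h2 h.2), if_pos h1, hlen _ (by omega), iterate_map_zero, mul_zero]
  · rw [if_neg (fun h => h1 h.1), if_neg h1]

/-- The simple transformation `i` on `j` at position `h`: with
`β = deg v_{j,h} - deg v_{i,h}` and `α = LC(v_{j,h}) / θ^β(LC(v_{i,h}))`,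
replace row `j` by `v_j - α x^β v_i`. -/
def simpleTransformation {m : ℕ} (V : Matrix (Fin m) (Fin m) (SkewPolynomial F))
    (i j h : Fin m) : Counted (Matrix (Fin m) (Fin m) (SkewPolynomial F)) := do
  let β := natDeg (V j h) - natDeg (V i h)
  let l ← Counted.theta β (leadCoeff (V i h))
  let α ← Counted.div (leadCoeff (V j h)) l
  let row ← Counted.forAll fun c => subScaled α β (V i c) (V j c)
  pure (V.updateRow j row)

/-- The simple transformation replaces row `j` by `v_j - α x^β v_i`. -/
theorem simpleTransformation_val {m : ℕ} (V : Matrix (Fin m) (Fin m) (SkewPolynomial F))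
    (i j h : Fin m) :
    (simpleTransformation V i j h).val = V.updateRow j (V j -
      (SkewPolynomial.C (leadCoeff (V j h) /
          SkewPolynomial.φ^[natDeg (V j h) - natDeg (V i h)] (leadCoeff (V i h))) *
        SkewPolynomial.X ^ (natDeg (V j h) - natDeg (V i h))) • V i) := by
  rw [SkewPolynomial.C_mul_X_pow_eq_monomial]
  change V.updateRow j (fun c => (subScaled _ _ (V i c) (V j c)).val) = _
  congr 1
  ext1 c
  rw [subScaled_val]
  rfl

/-- One pass of the loop body of weak Popov walking; the state is the current matrix together with
the current index `t`. -/
def walkLoop {m : ℕ} [NeZero m] (s : Matrix (Fin m) (Fin m) (SkewPolynomial F) × Fin m)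
    (i : Fin m) : Counted (Matrix (Fin m) (Fin m) (SkewPolynomial F) × Fin m) :=
  if deg (s.1 s.2 0) ≤ deg (s.1 i 0) then do
    let V ← simpleTransformation s.1 s.2 i 0
    pure (V, s.2)
  else do
    let V ← simpleTransformation s.1 i s.2 0
    pure (V, i)

/-- The shift `w + (1, 0, …, 0)`. -/
def bumpShift {m : ℕ} [NeZero m] (w : Fin m → ℕ) : Fin m → ℕ := w + Pi.single 0 1

/-- The list of the indices `i` whose row has `(w + (1, 0, …, 0))`-shifted leading position `0`,
sorted by increasing `w`-shifted leading position. -/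
def walkIndices {m : ℕ} [NeZero m] (w : Fin m → ℕ)
    (V : Matrix (Fin m) (Fin m) (SkewPolynomial F)) : List (Fin m) :=
  ((List.finRange m).filter fun i =>
      shiftedLeadPos (bumpShift w) (V i) = ((0 : Fin m) : WithBot (Fin m))).insertionSort
    fun i j => shiftedLeadPos w (V i) ≤ shiftedLeadPos w (V j)

/-- One step of weak Popov walking, from the shift `w` to the shift `w + (1, 0, …, 0)`. -/
def weakPopovWalk {m : ℕ} [NeZero m] (w : Fin m → ℕ)
    (V : Matrix (Fin m) (Fin m) (SkewPolynomial F)) :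
    Counted (Matrix (Fin m) (Fin m) (SkewPolynomial F)) :=
  match walkIndices w V with
  | [] => pure V
  | t :: is => do
    let s ← is.foldlM walkLoop (V, t)
    pure s.1

end Algorithm

end WeakPopov
end

noncomputable section
open scoped Matrix
namespace WeakPopov

/-! ### Degrees and lengths; the codimension of the row space -/

section Uniqueness

variable {F : Type*} [Field F]

/-! Each pass of the loop is charged to the index `i` that it takes from the list, and its cost is
bounded by the degree of the leading entry of row `i` of the original matrix.

Subtracting a multiple of row `u` costs two operations for the factor and three for each coefficient
of row `u`. The subtracted row is always still in its original state: a row that has been changed is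
either already passed or has just ceased to be the row `t`. It also satisfies `deg v_{u,0} ≤ deg
v_{i,0}`, since it is the row of smaller degree or row `i` itself (`ops_foldlM_walkLoop_le`). As
position 0 leads row `u` for the new shift, `deg v_{u,c} ≤ deg v_{u,0} + w_0 - w_c`. Let `h_i` be
the old leading position of row `i`. Then `deg v_{u,c} ≤ deg v_{i,0} + w_0 - w_c ≤ deg v_{i,h_i} +
w_{h_i} - w_c`. Summing over `i` and `c`, and using that `h` is a permutation, gives `m ∑ deg
v_{i,h_i}`, twice `∑_{i<j} |w_i - w_j|`, and terms of order `m^2`.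

It remains to bound `∑ deg v_{i,h_i}` by the determinant degree (`sum_natDeg_le_degDet`). Only the
three characterizing properties of `degDet` are known, so it is first identified with the dimension
over `F` of the cokernel of `v ↦ v V` (`IsDegDet.eq_codim`): both functions satisfy these
properties, and every matrix is built from invertible and diagonal ones. The vectors whose entry at
`h_i` has degree below `deg v_{i,h_i}` form a space of dimension `∑ deg v_{i,h_i}`; it meets the row
space only in 0 (`eq_zero_of_rowMap_mem_boxed`), hence embeds into the cokernel. -/

theorem natDeg_eq_of_coeff {p : SkewPolynomial F} {n : ℕ} (h : SkewPolynomial.coeff p n ≠ 0)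
    (h' : ∀ k, n < k → SkewPolynomial.coeff p k = 0) : natDeg p = n := by
  refine le_antisymm (Finset.sup_le fun k hk => ?_) (Finset.le_sup (f := id) (mem_supp.2 h))
  by_contra hc
  exact mem_supp.1 hk (h' k (by simpa using hc))

theorem len_zero : len (0 : SkewPolynomial F) = 0 := rfl

theorem len_le (p : SkewPolynomial F) : len p ≤ natDeg p + 1 :=
  Finset.sup_le fun _ hk => Nat.succ_le_succ (Finset.le_sup (f := id) hk)

theorem len_pos {p : SkewPolynomial F} (hp : p ≠ 0) : natDeg p < len p :=
  Finset.le_sup (f := Nat.succ) (mem_supp.2 (leadCoeff_ne_zero hp))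

theorem len_le_iff {p : SkewPolynomial F} {n : ℕ} :
    len p ≤ n ↔ ∀ k, n ≤ k → SkewPolynomial.coeff p k = 0 := by
  constructor
  · intro h k hk
    by_contra hc
    have : k + 1 ≤ len p := Finset.le_sup (f := Nat.succ) (mem_supp.2 hc)
    omega
  · intro h
    refine Finset.sup_le fun k hk => ?_
    by_contra hc
    exact mem_supp.1 hk (h k (by simpa using hc))

variable [MulSemiringAction (Multiplicative ℕ) F]

open Classical in
/-- The codimension of the row space, and `⊥` for a matrix with dependent rows. -/
def codim {m : ℕ} (A : Matrix (Fin m) (Fin m) (SkewPolynomial F)) : WithBot ℕ :=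
  if Function.Injective (rowMap A) then
    ((Module.finrank F ((Fin m → SkewPolynomial F) ⧸ LinearMap.range (rowMap A)) : ℕ) :
      WithBot ℕ) else ⊥

theorem codim_of_injective {m : ℕ} {A : Matrix (Fin m) (Fin m) (SkewPolynomial F)}
    (h : Function.Injective (rowMap A)) : codim A =
      (Module.finrank F ((Fin m → SkewPolynomial F) ⧸ LinearMap.range (rowMap A)) : ℕ) :=
  if_pos h

theorem codim_of_not_injective {m : ℕ} {A : Matrix (Fin m) (Fin m) (SkewPolynomial F)}
    (h : ¬ Function.Injective (rowMap A)) : codim A = ⊥ :=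
  if_neg h

/-- Cokernel dimensions add along a composition of injections. The value `⊥` is absorbing because an
injective product forces both factors to be injective, by `injective_of_mul`. -/
theorem codim_mul {m : ℕ} (A B : Matrix (Fin m) (Fin m) (SkewPolynomial F)) :
    codim (A * B) = codim A + codim B := by
  by_cases hA : Function.Injective (rowMap A)
  · by_cases hB : Function.Injective (rowMap B)
    · have hAB : Function.Injective (rowMap (A * B)) := by
        rw [rowMap_mul]; exact hB.comp hA
      rw [codim_of_injective hA, codim_of_injective hB, codim_of_injective hAB,
        finrank_coker_mul hA hB, Nat.cast_add]
    · rw [codim_of_not_injective hB, WithBot.add_bot,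
        codim_of_not_injective fun h => hB (injective_of_mul h).2]
  · rw [codim_of_not_injective hA, WithBot.bot_add,
      codim_of_not_injective fun h => hA (injective_of_mul h).1]

theorem codim_isUnit {m : ℕ} {U : Matrix (Fin m) (Fin m) (SkewPolynomial F)} (hU : IsUnit U) :
    codim U = 0 := by
  obtain ⟨W, h1, h2⟩ := isUnit_iff_exists.1 hU
  have e1 : ∀ v, rowMap W (rowMap U v) = v := fun v => by
    rw [← LinearMap.comp_apply, ← rowMap_mul, h1]; exact Matrix.vecMul_one v
  have e2 : ∀ v, rowMap U (rowMap W v) = v := fun v => by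
    rw [← LinearMap.comp_apply, ← rowMap_mul, h2]; exact Matrix.vecMul_one v
  have hinj : Function.Injective (rowMap U) := Function.LeftInverse.injective e1
  have h0 : Module.finrank F
      ((Fin m → SkewPolynomial F) ⧸ LinearMap.range (rowMap U)) = 0 := by
    rw [LinearMap.range_eq_top.2 (Function.RightInverse.surjective e2)]
    exact Module.finrank_zero_of_subsingleton
  rw [codim_of_injective hinj, h0, Nat.cast_zero]

theorem codim_diagonal {m : ℕ} (d : Fin m → SkewPolynomial F) :
    codim (Matrix.diagonal d) = ∑ i, deg (d i) := by
  by_cases hd : ∀ i, d i ≠ 0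
  · have hinj : Function.Injective (rowMap (Matrix.diagonal d)) := by
      rw [← LinearMap.ker_eq_bot, LinearMap.ker_eq_bot']
      intro v hv
      ext1 i
      have := congrFun hv i
      rw [rowMap_diagonal_apply] at this
      exact (mul_eq_zero.1 this).resolve_right (hd i)
    simp only [codim_of_injective hinj, finrank_coker_diagonal d hd, deg_eq_natDeg (hd _)]
    push_cast
    rfl
  · push Not at hd
    obtain ⟨i, hi⟩ := hd
    have hinj : ¬ Function.Injective (rowMap (Matrix.diagonal d)) := by
      intro h
      have h0 : rowMap (Matrix.diagonal d) (Pi.single i 1) = 0 := by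
        ext1 j
        rw [rowMap_diagonal_apply]
        by_cases hj : j = i
        · subst hj; rw [hi, mul_zero]; rfl
        · rw [Pi.single_eq_of_ne hj, zero_mul]; rfl
      have := congrFun (h (h0.trans (map_zero _).symm)) i
      rw [Pi.single_eq_same] at this
      exact one_ne_zero (SkewPolynomial.coeff_one_zero.symm.trans
        (congrArg (fun p => SkewPolynomial.coeff p 0) this))
    have hbot : deg (d i) = ⊥ := by rw [hi]; rfl
    rw [codim_of_not_injective hinj, ← Finset.add_sum_erase _ _ (Finset.mem_univ i), hbot,
      WithBot.bot_add]

end Uniqueness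

section Factorization

/-! ### Row reduction -/

variable {R : Type*} [Ring R] {m : ℕ}

theorem updateRow_one_mul (i : Fin m) (t : Fin m → R) (A : Matrix (Fin m) (Fin m) R) :
    (1 : Matrix (Fin m) (Fin m) R).updateRow i t * A = A.updateRow i (t ᵥ* A) := by
  rw [Matrix.updateRow_mul, one_mul]

/-- Negating the off-diagonal entries of the special row inverts the matrix. The hypotheses are
symmetric in `t` and `t'`, so this serves for both the left and the right inverse. -/
theorem updateRow_one_mul_add (i : Fin m) {t t' : Fin m → R} (ht : t i = 1) (ht' : t' i = 1)
    (h : ∀ j, j ≠ i → t j + t' j = 0) :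
    (1 : Matrix (Fin m) (Fin m) R).updateRow i t * (1 : Matrix (Fin m) (Fin m) R).updateRow i t' =
      1 := by
  rw [updateRow_one_mul, Matrix.updateRow_idem]
  ext a b
  by_cases ha : a = i
  · subst ha
    rw [Matrix.updateRow_self, Matrix.vecMul, dotProduct,
      ← Finset.add_sum_erase _ _ (Finset.mem_univ a), Matrix.updateRow_self, ht, one_mul]
    have : ∑ x ∈ Finset.univ.erase a, t x * (Matrix.updateRow 1 a t' : Matrix (Fin m) (Fin m) R) x b =
        ∑ x ∈ Finset.univ.erase a, t x * (1 : Matrix (Fin m) (Fin m) R) x b :=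
      Finset.sum_congr rfl fun x hx => by rw [Matrix.updateRow_ne (Finset.ne_of_mem_erase hx)]
    rw [this]
    by_cases hb : b = a
    · subst hb
      rw [Finset.sum_eq_zero, ht', Matrix.one_apply_eq, add_zero]
      intro x hx
      rw [Matrix.one_apply_ne (Finset.ne_of_mem_erase hx), mul_zero]
    · rw [Finset.sum_eq_single_of_mem b (Finset.mem_erase.2 ⟨hb, Finset.mem_univ b⟩),
        Matrix.one_apply_eq, mul_one, add_comm, h b hb, Matrix.one_apply_ne (Ne.symm hb)]
      intro x _ hx
      rw [Matrix.one_apply_ne hx, mul_zero]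
  · rw [Matrix.updateRow_ne ha]

/-- A matrix that differs from the identity only in row `i`, with diagonal entry `1`, is
invertible. -/
theorem isUnit_updateRow_one (i : Fin m) {t : Fin m → R} (ht : t i = 1) :
    IsUnit ((1 : Matrix (Fin m) (Fin m) R).updateRow i t) := by
  let t' : Fin m → R := fun j => if j = i then 1 else -t j
  have ht' : t' i = 1 := if_pos rfl
  have h : ∀ j, j ≠ i → t j + t' j = 0 := fun j hj => by
    rw [show t' j = -t j from if_neg hj, add_neg_cancel]
  exact isUnit_iff_exists.2 ⟨_, updateRow_one_mul_add i ht ht' h,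
    updateRow_one_mul_add i ht' ht fun j hj => by rw [add_comm, h j hj]⟩

/-- A submonoid of matrices with the invertible and the diagonal ones contains the upper
triangular ones. -/
theorem mem_of_upperTriangular {S : Submonoid (Matrix (Fin m) (Fin m) R)}
    (hU : ∀ U, IsUnit U → U ∈ S) (hD : ∀ d, Matrix.diagonal d ∈ S)
    {T : Matrix (Fin m) (Fin m) R} (hT : ∀ i j, j < i → T i j = 0) : T ∈ S := by
  have hrow : ∀ i (t : Fin m → R), (1 : Matrix (Fin m) (Fin m) R).updateRow i t ∈ S := by
    intro i t
    -- The diagonal entry `t i` is split off as a diagonal factor on the right; it scales column `i`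
    -- only, where the other rows of the remaining factor vanish.
    have : (1 : Matrix (Fin m) (Fin m) R).updateRow i t =
        (1 : Matrix (Fin m) (Fin m) R).updateRow i (Function.update t i 1) *
          Matrix.diagonal (Function.update 1 i (t i)) := by
      ext a b
      rw [Matrix.mul_diagonal]
      by_cases ha : a = i
      · subst ha
        rw [Matrix.updateRow_self, Matrix.updateRow_self]
        by_cases hb : b = a
        · subst hb; simp
        · simp [hb]
      · rw [Matrix.updateRow_ne ha, Matrix.updateRow_ne ha]
        by_cases hb : b = i
        · subst hb; rw [Matrix.one_apply_ne ha, zero_mul]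
        · simp [hb]
    rw [this]
    exact S.mul_mem (hU _ (isUnit_updateRow_one i (by simp))) (hD _)
  have key : ∀ k : ℕ, k ≤ m →
      (Matrix.of fun i : Fin m => if (i : ℕ) < k then T i else (1 : Matrix (Fin m) (Fin m) R) i) ∈ S := by
    intro k
    induction k with
    | zero =>
      intro _
      convert S.one_mem using 1
      ext i j
      simp
    | succ k ih =>
      intro hk
      -- Row `k` of `T` vanishes in front of the diagonal, so it meets only the identity rows of the
      -- partial product and is reproduced unchanged.
      have := S.mul_mem (hrow ⟨k, hk⟩ (T ⟨k, hk⟩)) (ih (by omega))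
      rw [updateRow_one_mul] at this
      convert this using 1
      ext a b
      by_cases ha : a = ⟨k, hk⟩
      · subst ha
        rw [Matrix.updateRow_self, Matrix.vecMul, dotProduct, Finset.sum_eq_single b]
        · by_cases hb : (b : ℕ) < k
          · simp [hb, hT ⟨k, hk⟩ b hb]
          · simp [hb]
        · intro x _ hx
          by_cases hb : (x : ℕ) < k
          · rw [hT ⟨k, hk⟩ x hb, zero_mul]
          · simp [hb, Matrix.one_apply_ne hx]
        · simp
      · have hak : (a : ℕ) ≠ k := fun h => ha (Fin.ext h)
        rw [Matrix.updateRow_ne ha]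
        simp only [Matrix.of_apply, Nat.lt_succ_iff_lt_or_eq, hak, or_false]
  convert key m le_rfl using 1
  ext i j
  simp

end Factorization

/-! ### Uniqueness of the determinant degree -/

section Uniqueness

variable {F : Type*} [Field F] [MulSemiringAction (Multiplicative ℕ) F] {m : ℕ}

theorem exists_len_sub_lt {q : SkewPolynomial F} (hq : q ≠ 0) (p : SkewPolynomial F) :
    ∃ a : SkewPolynomial F, len (p + a * q) < len q := by
  obtain ⟨a, ha⟩ := exists_div hq p
  refine ⟨-a, lt_of_le_of_lt (len_le_iff.2 fun k hk => ?_) (len_pos hq)⟩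
  rw [neg_mul, ← sub_eq_add_neg]
  exact ha k hk

/-- Row reduction to upper triangular form. -/
theorem induction_upperTriangular {P : Matrix (Fin m) (Fin m) (SkewPolynomial F) → Prop}
    (htri : ∀ T, (∀ i j, j < i → T i j = 0) → P T)
    (hadd : ∀ (A : Matrix (Fin m) (Fin m) (SkewPolynomial F)) (i j : Fin m) (c : SkewPolynomial F),
      i ≠ j → P (A.updateRow i (A i + c • A j)) → P A)
    (A : Matrix (Fin m) (Fin m) (SkewPolynomial F)) : P A := by
  have clear : ∀ n : ℕ, ∀ A : Matrix (Fin m) (Fin m) (SkewPolynomial F), ∀ k i : Fin m, k < i →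
      len (A i k) ≤ n →
      (∀ a b, b < k → b < a → A a b = 0) → (∀ a, k < a → a < i → A a k = 0) →
      (∀ A' : Matrix (Fin m) (Fin m) (SkewPolynomial F), (∀ a b, b < k → b < a → A' a b = 0) →
        (∀ a, k < a → a ≤ i → A' a k = 0) → P A') → P A := by
    intro n
    induction n with
    | zero =>
      intro A k i hki hlen hA hA' hP
      refine hP A hA fun a hka hai => ?_
      rcases hai.eq_or_lt with rfl | h
      · exact SkewPolynomial.ext fun j => len_le_iff.1 hlen j (Nat.zero_le j)
      · exact hA' a hka h
    | succ n ih =>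
      intro A k i hki hlen hA hA' hP
      by_cases h0 : A i k = 0
      · exact ih A k i hki (by rw [h0, len_zero]; omega) hA hA' hP
      obtain ⟨q, hq⟩ := exists_len_sub_lt h0 (A k k)
      -- A Euclidean step without a row swap: with remainder `r = A k k + q * A i k`, the two
      -- additions turn the pair `(A k k, A i k)` into `(r + A i k, -r)`, and `-r` is shorter than
      -- `A i k`.
      refine hadd A k i (q + 1) hki.ne (hadd _ i k (-1) hki.ne' (ih _ k i hki ?_ ?_ ?_ hP))
      · have h1 : A i k + -1 * (A k k + (q + 1) * A i k) = -(A k k + q * A i k) := by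
          rw [add_mul, one_mul, neg_one_mul]
          abel
        have h2 : len (-(A k k + q * A i k)) ≤ len (A k k + q * A i k) :=
          len_le_iff.2 fun j hj => by
            rw [← zero_sub, coeff_sub', len_le_iff.1 le_rfl j hj, SkewPolynomial.coeff_zero,
              sub_zero]
        rw [Matrix.updateRow_self, Matrix.updateRow_self, Matrix.updateRow_ne hki.ne']
        simp only [Pi.add_apply, Pi.smul_apply, smul_eq_mul]
        rw [h1]
        omega
      · intro a b hb hba
        by_cases hai : a = i
        · subst hai
          rw [Matrix.updateRow_self, Matrix.updateRow_self, Matrix.updateRow_ne hki.ne']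
          simp [hA a b hb hba, hA k b hb hb]
        · rw [Matrix.updateRow_ne hai]
          by_cases hak : a = k
          · subst hak
            rw [Matrix.updateRow_self]
            simp [hA a b hb hba, hA i b hb (hb.trans hki)]
          · rw [Matrix.updateRow_ne hak, hA a b hb hba]
      · intro a hka hai
        rw [Matrix.updateRow_ne hai.ne, Matrix.updateRow_ne hka.ne', hA' a hka hai]
  have cols : ∀ e k : ℕ, k + e = m → ∀ A : Matrix (Fin m) (Fin m) (SkewPolynomial F),
      (∀ a b : Fin m, (b : ℕ) < k → b < a → A a b = 0) → P A := by
    intro e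
    induction e with
    | zero => exact fun k hk A hA => htri A fun i j hj => hA i j (by omega) hj
    | succ e ih =>
      intro k hk
      have rows : ∀ f l : ℕ, l + f = m → ∀ A : Matrix (Fin m) (Fin m) (SkewPolynomial F),
          (∀ a b : Fin m, (b : ℕ) < k → b < a → A a b = 0) →
          (∀ a : Fin m, k < a → (a : ℕ) < l → A a ⟨k, by omega⟩ = 0) → P A := by
        intro f
        induction f with
        | zero =>
          intro l hl A hA hA'
          refine ih (k + 1) (by omega) A fun a b hb hba => ?_
          rcases Nat.lt_succ_iff_lt_or_eq.1 hb with h | h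
          · exact hA a b h hba
          · subst h
            exact hA' a hba (by omega)
        | succ f ihf =>
          intro l hl A hA hA'
          -- Only rows below the diagonal need clearing; the others are skipped.
          by_cases hkl : k < l
          · exact clear _ A ⟨k, by omega⟩ ⟨l, by omega⟩ hkl le_rfl hA hA' fun A' h h' =>
              ihf (l + 1) (by omega) A' h fun a h1 h2 => h' a h1 (Nat.lt_succ_iff.1 h2)
          · exact ihf (l + 1) (by omega) A hA fun a h1 h2 => by omega
      exact fun A hA => rows m 0 (by omega) A hA fun a _ h => absurd h (Nat.not_lt_zero _)
  exact cols m 0 (by omega) A fun a b h => absurd h (Nat.not_lt_zero _)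

/-- The matrices on which the two functions agree form a submonoid with all invertible and all
diagonal matrices, hence all upper triangular ones. Row additions are invertible and change neither
value, so row reduction reaches every matrix. -/
theorem IsDegDet.eq_codim {D : Matrix (Fin m) (Fin m) (SkewPolynomial F) → WithBot ℕ}
    (hD : IsDegDet D) (A : Matrix (Fin m) (Fin m) (SkewPolynomial F)) : D A = codim A := by
  let S : Submonoid (Matrix (Fin m) (Fin m) (SkewPolynomial F)) :=
    { carrier := {A | D A = codim A}
      mul_mem' := fun {A B} (hA : D A = _) (hB : D B = _) => by
        change D (A * B) = _
        rw [hD.1, codim_mul, hA, hB]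
      one_mem' := by
        change D 1 = _
        rw [hD.2.1 1 isUnit_one, codim_isUnit isUnit_one] }
  have hU : ∀ U, IsUnit U → U ∈ S := fun U h => (hD.2.1 U h).trans (codim_isUnit h).symm
  change A ∈ S
  refine induction_upperTriangular (P := (· ∈ S)) (fun T hT => mem_of_upperTriangular hU
    (fun d => (hD.2.2 d).trans (codim_diagonal d).symm) hT) (fun A i j c hij h => ?_) A
  let t : Fin m → SkewPolynomial F := Pi.single i 1 + c • Pi.single j 1
  have ht : IsUnit ((1 : Matrix (Fin m) (Fin m) (SkewPolynomial F)).updateRow i t) :=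
    isUnit_updateRow_one i (by simp [t, hij])
  have he : A.updateRow i (A i + c • A j) =
      (1 : Matrix (Fin m) (Fin m) (SkewPolynomial F)).updateRow i t * A := by
    rw [updateRow_one_mul, Matrix.add_vecMul, Matrix.smul_vecMul, Matrix.single_one_vecMul,
      Matrix.single_one_vecMul]
    rfl
  change D _ = codim _ at h
  rwa [he, hD.1, codim_mul, hD.2.1 _ ht, codim_isUnit ht, zero_add, zero_add] at h

theorem degDet_eq_codim (A : Matrix (Fin m) (Fin m) (SkewPolynomial F)) : degDet A = codim A :=
  (Classical.choose_spec (exists_isDegDet F m)).eq_codim A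

end Uniqueness
-- Leading positions and the lower bound for the determinant degree
section LeadingPosition

variable {F : Type*} [Field F] {m : ℕ}

theorem exists_leadPos_eq {u : Fin m → SkewPolynomial F} (hu : u ≠ 0) :
    ∃ h : Fin m, leadPos u = h := by
  classical
  obtain ⟨j, hj⟩ := Function.ne_iff.1 hu
  obtain ⟨i, -, hi⟩ := Finset.exists_mem_eq_sup Finset.univ ⟨j, Finset.mem_univ j⟩
    fun i => deg (u i)
  have hi0 : u i ≠ 0 := by
    intro h0
    have h1 : deg (u j) ≤ deg (u i) := hi ▸ Finset.le_sup (f := fun i => deg (u i)) (Finset.mem_univ j)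
    rw [h0, deg_eq_natDeg hj] at h1
    exact absurd (le_bot_iff.1 h1) (WithBot.coe_ne_bot)
  exact Finset.max_of_mem (Finset.mem_filter.2 ⟨Finset.mem_univ i, hi0, hi.symm⟩)

theorem leadPos_eq_coe {u : Fin m → SkewPolynomial F} {h : Fin m} (hu : leadPos u = h) :
    u h ≠ 0 ∧ (∀ c, u c ≠ 0 → natDeg (u c) ≤ natDeg (u h)) ∧
      ∀ c, u c ≠ 0 → h < c → natDeg (u c) < natDeg (u h) := by
  classical
  obtain ⟨-, h0, hd⟩ := Finset.mem_filter.1 (Finset.mem_of_max hu)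
  have hle : ∀ c, u c ≠ 0 → natDeg (u c) ≤ natDeg (u h) := by
    intro c hc
    have : deg (u c) ≤ deg (u h) :=
      hd ▸ Finset.le_sup (f := fun i => deg (u i)) (Finset.mem_univ c)
    rw [deg_eq_natDeg hc, deg_eq_natDeg h0] at this
    exact WithBot.coe_le_coe.1 this
  refine ⟨h0, hle, fun c hc hlt => lt_of_le_of_ne (hle c hc) fun he => ?_⟩
  have hmem : c ∈ Finset.univ.filter fun i => u i ≠ 0 ∧ deg (u i) = vecDeg u :=
    Finset.mem_filter.2 ⟨Finset.mem_univ c, hc, by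
      rw [← hd, deg_eq_natDeg hc, deg_eq_natDeg h0, he]⟩
  exact absurd (Finset.le_max_of_eq hmem hu) (not_le_of_gt hlt)

variable [MulSemiringAction (Multiplicative ℕ) F]

theorem X_pow_ne_zero (k : ℕ) : (SkewPolynomial.X : SkewPolynomial F) ^ k ≠ 0 := by
  rw [← SkewPolynomial.monomial_one_right_eq_X_pow]
  exact fun h => one_ne_zero ((SkewPolynomial.monomial_eq_zero_iff k _).1 h)

theorem natDeg_mul {p q : SkewPolynomial F} (hp : p ≠ 0) (hq : q ≠ 0) :
    natDeg (p * q) = natDeg p + natDeg q := by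
  refine natDeg_eq_of_coeff ?_ fun k hk => ?_
  · rw [coeff_mul_top (fun k => coeff_eq_zero_of_natDeg_lt) (fun k => coeff_eq_zero_of_natDeg_lt)]
    exact mul_ne_zero (leadCoeff_ne_zero hp) (iter_ne_zero _ (leadCoeff_ne_zero hq))
  · exact coeff_mul_high (a := natDeg p + 1) (fun k => coeff_eq_zero_of_natDeg_lt)
      (fun k => coeff_eq_zero_of_natDeg_lt) (by omega)

theorem natDeg_mul_X_pow {p : SkewPolynomial F} (hp : p ≠ 0) (k : ℕ) :
    natDeg (p * SkewPolynomial.X ^ k) = natDeg p + k := by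
  rw [natDeg_mul hp (X_pow_ne_zero k), ← SkewPolynomial.monomial_one_right_eq_X_pow]
  congr 1
  exact natDeg_eq_of_coeff (by simp [SkewPolynomial.coeff_monomial]) fun j hj => by
    rw [SkewPolynomial.coeff_monomial, if_neg hj.ne]

theorem shiftVec_apply_ne_zero {w : Fin m → ℕ} {v : Fin m → SkewPolynomial F} {c : Fin m} :
    shiftVec w v c ≠ 0 ↔ v c ≠ 0 :=
  ⟨left_ne_zero_of_mul, fun h => mul_ne_zero h (X_pow_ne_zero _)⟩

theorem shiftVec_ne_zero {w : Fin m → ℕ} {v : Fin m → SkewPolynomial F} (hv : v ≠ 0) :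
    shiftVec w v ≠ 0 := by
  obtain ⟨i, hi⟩ := Function.ne_iff.1 hv
  exact Function.ne_iff.2 ⟨i, shiftVec_apply_ne_zero.2 hi⟩

/-- Multiplication by `x^{w_c}` adds `w_c` to the degree of a nonzero entry. Strictness to the right
of `h` holds because the leading position is the last entry of maximal degree. -/
theorem shiftedLeadPos_eq_coe {w : Fin m → ℕ} {v : Fin m → SkewPolynomial F} {h : Fin m}
    (hv : shiftedLeadPos w v = h) :
    v h ≠ 0 ∧ (∀ c, v c ≠ 0 → natDeg (v c) + w c ≤ natDeg (v h) + w h) ∧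
      ∀ c, v c ≠ 0 → h < c → natDeg (v c) + w c < natDeg (v h) + w h := by
  obtain ⟨h0, h1, h2⟩ := leadPos_eq_coe hv
  rw [shiftVec_apply_ne_zero] at h0
  have hn : ∀ c, v c ≠ 0 → natDeg (shiftVec w v c) = natDeg (v c) + w c :=
    fun c hc => natDeg_mul_X_pow hc _
  refine ⟨h0, fun c hc => ?_, fun c hc hlt => ?_⟩
  · rw [← hn c hc, ← hn h h0]
    exact h1 c (shiftVec_apply_ne_zero.2 hc)
  · rw [← hn c hc, ← hn h h0]
    exact h2 c (shiftVec_apply_ne_zero.2 hc) hlt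

/-- A combination of rows with different leading positions is zero if its entries have degrees
below those of the leading entries. -/
theorem eq_zero_of_rowMap_mem_boxed {w : Fin m → ℕ}
    {V : Matrix (Fin m) (Fin m) (SkewPolynomial F)} {h : Fin m → Fin m}
    (hinj : Function.Injective h) (hV : ∀ i, shiftedLeadPos w (V i) = h i) {n : Fin m → ℕ}
    (hn : ∀ i, n (h i) = natDeg (V i (h i))) {a : Fin m → SkewPolynomial F}
    (ha : rowMap V a ∈ boxed n) : a = 0 := by
  classical
  by_contra hne
  obtain ⟨j, hj⟩ := Function.ne_iff.1 hne
  -- Among the summands `a i • V i`, one of maximal shifted degree is taken, and among these the one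
  -- that leads furthest to the right. Its leading term at column `h i` cannot cancel, yet its
  -- degree is too large for the box.
  obtain ⟨i, hi, hmax⟩ := Finset.exists_max_image (Finset.univ.filter fun i => a i ≠ 0)
    (fun i => toLex (natDeg (a i) + natDeg (V i (h i)) + w (h i), h i))
    ⟨j, Finset.mem_filter.2 ⟨Finset.mem_univ j, hj⟩⟩
  have hi0 : a i ≠ 0 := (Finset.mem_filter.1 hi).2
  have hc := ha (h i) (natDeg (a i) + natDeg (V i (h i))) (by rw [hn]; omega)
  change coeffHom _ (∑ k, a k * V k (h i)) = 0 at hc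
  rw [map_sum, Finset.sum_eq_single i] at hc
  · change SkewPolynomial.coeff _ _ = 0 at hc
    rw [coeff_mul_top (fun k => coeff_eq_zero_of_natDeg_lt)
      (fun k => coeff_eq_zero_of_natDeg_lt)] at hc
    exact mul_ne_zero (leadCoeff_ne_zero hi0)
      (iter_ne_zero _ (leadCoeff_ne_zero (shiftedLeadPos_eq_coe (hV i)).1)) hc
  · intro k _ hki
    change SkewPolynomial.coeff _ _ = 0
    by_cases hak : a k = 0
    · rw [hak, zero_mul, SkewPolynomial.coeff_zero]
    by_cases hvk : V k (h i) = 0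
    · rw [hvk, mul_zero, SkewPolynomial.coeff_zero]
    apply coeff_eq_zero_of_natDeg_lt
    rw [natDeg_mul hak hvk]
    have h1 := (shiftedLeadPos_eq_coe (hV k)).2.1 _ hvk
    have h2 := (shiftedLeadPos_eq_coe (hV k)).2.2 _ hvk
    have h3 := hmax k (Finset.mem_filter.2 ⟨Finset.mem_univ k, hak⟩)
    rw [Prod.Lex.toLex_le_toLex] at h3
    -- Strict inequality comes from the leading position of row `k` if `h k < h i`, and from the
    -- lexicographic choice of `i` if `h k > h i`.
    rcases lt_trichotomy (h k) (h i) with hlt | heq | hgt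
    · have := h2 hlt
      rcases h3 with h3 | ⟨h3, -⟩ <;> simp only at h3 <;> omega
    · exact absurd (hinj heq) hki
    · rcases h3 with h3 | ⟨-, h3⟩
      · simp only at h3; omega
      · exact absurd h3 (not_le_of_gt hgt)
  · simp

/-- The determinant degree of a matrix in shifted weak Popov form is at least the sum of the
degrees of its leading entries. -/
theorem sum_natDeg_le_degDet {w : Fin m → ℕ}
    {V : Matrix (Fin m) (Fin m) (SkewPolynomial F)} {h : Fin m → Fin m}
    (hinj : Function.Injective h) (hV : ∀ i, shiftedLeadPos w (V i) = h i) {d : ℕ}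
    (hd : degDet V = (d : WithBot ℕ)) : ∑ i, natDeg (V i (h i)) ≤ d := by
  let e : Fin m ≃ Fin m := Equiv.ofBijective h (Finite.injective_iff_bijective.1 hinj)
  -- The box is indexed by columns, so the leading degrees are transported along the permutation
  -- `h`.
  let n : Fin m → ℕ := fun c => natDeg (V (e.symm c) c)
  have hn : ∀ i, n (h i) = natDeg (V i (h i)) := fun i => by
    change natDeg (V (e.symm (e i)) _) = _
    rw [e.symm_apply_apply]
  have hker {a} : rowMap V a ∈ boxed n → a = 0 := eq_zero_of_rowMap_mem_boxed hinj hV hn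
  have hVinj : Function.Injective (rowMap V) := by
    rw [← LinearMap.ker_eq_bot, LinearMap.ker_eq_bot']
    exact fun a ha => hker (by rw [ha]; exact zero_mem _)
  have := finite_coker hVinj
  have hg : Function.Injective ((LinearMap.range (rowMap V)).mkQ ∘ₗ (boxed (F := F) n).subtype) := by
    rw [← LinearMap.ker_eq_bot, LinearMap.ker_eq_bot']
    rintro ⟨v, hv⟩ hx
    obtain ⟨a, rfl⟩ := (Submodule.Quotient.mk_eq_zero _).1 hx
    have h0 := hker hv
    subst h0
    exact Subtype.ext (map_zero _)
  have hle := LinearMap.finrank_le_finrank_of_injective hg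
  rw [finrank_boxed] at hle
  rw [degDet_eq_codim, codim_of_injective hVinj] at hd
  refine le_trans ?_ (hle.trans_eq (WithBot.coe_inj.1 hd))
  calc ∑ i, natDeg (V i (h i)) = ∑ i, n (e i) := Finset.sum_congr rfl fun i _ => (hn i).symm
    _ = ∑ i, n i := e.sum_comp n
    _ ≤ _ := le_rfl

theorem row_ne_zero_of_degDet_eq_coe {V : Matrix (Fin m) (Fin m) (SkewPolynomial F)} {d : ℕ}
    (hd : degDet V = (d : WithBot ℕ)) (i : Fin m) : V i ≠ 0 := by
  intro h0
  rw [degDet_eq_codim] at hd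
  by_cases hV : Function.Injective (rowMap V)
  · have h1 : rowMap V (Pi.single i 1) = rowMap V 0 := by
      rw [map_zero]
      exact (Matrix.single_one_vecMul i V).trans h0
    have := congrFun (hV h1) i
    rw [Pi.single_eq_same] at this
    exact one_ne_zero (SkewPolynomial.coeff_one_zero.symm.trans
      (congrArg (fun p => SkewPolynomial.coeff p 0) this))
  · rw [codim_of_not_injective hV] at hd
    exact WithBot.coe_ne_bot hd.symm

end LeadingPosition

/-! ### Counting operations -/

section Cost

variable {F : Type*} [Field F] [MulSemiringAction (Multiplicative ℕ) F] {m : ℕ}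

/-- Every pass costs three operations whatever the accumulator holds, so the induction runs over an
arbitrary list and an arbitrary start. -/
theorem ops_subScaled (α : F) (β : ℕ) (p q : SkewPolynomial F) :
    (subScaled α β p q).ops = 3 * len p := by
  have key : ∀ (l : List ℕ) (q : SkewPolynomial F), (l.foldlM (m := Counted) (fun r k => do
      let a ← Counted.theta β (SkewPolynomial.coeff p k)
      let b ← Counted.mul α a
      let c ← Counted.sub (SkewPolynomial.coeff r (k + β)) b
      pure (SkewPolynomial.update r (k + β) c)) q).ops = 3 * l.length := by
    intro l
    induction l with
    | nil => exact fun q => rfl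
    | cons k l ih =>
      intro q
      rw [List.foldlM_cons, List.length_cons, Nat.mul_succ, Nat.add_comm (3 * _)]
      exact congrArg (3 + ·) (ih _)
  rw [subScaled, key, List.length_range]

theorem ops_simpleTransformation (V : Matrix (Fin m) (Fin m) (SkewPolynomial F))
    (i j h : Fin m) : (simpleTransformation V i j h).ops = 2 + 3 * ∑ c, len (V i c) := by
  change 1 + (1 + (∑ c, (subScaled _ _ (V i c) (V j c)).ops + 0)) = _
  rw [add_zero, ← add_assoc, Finset.mul_sum]
  exact congrArg (2 + ·) (Finset.sum_congr rfl fun c _ => ops_subScaled _ _ (V i c) (V j c))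

theorem simpleTransformation_val_ne (V : Matrix (Fin m) (Fin m) (SkewPolynomial F))
    {i j h k : Fin m} (hk : k ≠ j) : (simpleTransformation V i j h).val k = V k := by
  rw [simpleTransformation_val, Matrix.updateRow_ne hk]

/-- The loop only ever subtracts multiples of rows that it has not changed yet. -/
theorem ops_foldlM_walkLoop_le [NeZero m] (V : Matrix (Fin m) (Fin m) (SkewPolynomial F))
    (g : Fin m → ℕ) (l : List (Fin m)) : ∀ (V' : Matrix (Fin m) (Fin m) (SkewPolynomial F))
    (t : Fin m), (t :: l).Nodup → (∀ i ∈ t :: l, V' i = V i) →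
    (∀ u ∈ t :: l, ∀ i ∈ t :: l, deg (V u 0) ≤ deg (V i 0) → 2 + 3 * ∑ c, len (V u c) ≤ g i) →
    (l.foldlM walkLoop (V', t)).ops ≤ (l.map g).sum := by
  induction l with
  | nil => exact fun _ _ _ _ _ => le_rfl
  | cons i l ih =>
    intro V' t hnd hrow hg
    have hti : t ≠ i := fun h => (List.nodup_cons.1 hnd).1 (h ▸ List.mem_cons_self)
    have hnt : (t :: l).Nodup := hnd.sublist (by simp)
    have hni : (i :: l).Nodup := (List.nodup_cons.1 hnd).2
    have hst : ∀ k ∈ t :: l, k ∈ t :: i :: l := fun k hk => by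
      simp only [List.mem_cons] at hk ⊢; tauto
    have hsi : ∀ k ∈ i :: l, k ∈ t :: i :: l := fun k hk => List.mem_cons_of_mem t hk
    have hVt := hrow t (by simp)
    have hVi := hrow i (by simp)
    rw [List.foldlM_cons, List.map_cons, List.sum_cons]
    change (walkLoop (V', t) i).ops + (l.foldlM walkLoop (walkLoop (V', t) i).val).ops ≤ _
    by_cases hle : deg (V' t 0) ≤ deg (V' i 0)
    · have hw : walkLoop (V', t) i = ⟨((simpleTransformation V' t i 0).val, t),
          (simpleTransformation V' t i 0).ops + 0⟩ := if_pos hle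
      rw [hw]
      -- Row `i` is changed and left behind; `t` and the rest of the list stay original.
      refine add_le_add ?_ (ih _ _ hnt (fun k hk => ?_) fun u hu k hk =>
        hg u (hst u hu) k (hst k hk))
      · rw [add_zero, ops_simpleTransformation, hVt]
        exact hg t (by simp) i (by simp) (by rwa [hVt, hVi] at hle)
      · have hki : k ≠ i := by
          rintro rfl
          rcases List.mem_cons.1 hk with h | h
          · exact hti h.symm
          · exact (List.nodup_cons.1 hni).1 h
        rw [simpleTransformation_val_ne _ hki, hrow k (hst k hk)]
    · have hw : walkLoop (V', t) i = ⟨((simpleTransformation V' i t 0).val, i),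
          (simpleTransformation V' i t 0).ops + 0⟩ := if_neg hle
      rw [hw]
      -- Row `t` is changed and abandoned. The subtracted row is `i` itself, so the charge to `i`
      -- needs only `u = i` in `hg`.
      refine add_le_add ?_ (ih _ _ hni (fun k hk => ?_) fun u hu k hk =>
        hg u (hsi u hu) k (hsi k hk))
      · rw [add_zero, ops_simpleTransformation, hVi]
        exact hg i (by simp) i (by simp) le_rfl
      · have hkt : k ≠ t := by
          rintro rfl
          exact (List.nodup_cons.1 hnd).1 hk
        rw [simpleTransformation_val_ne _ hkt, hrow k (hsi k hk)]

theorem mem_walkIndices [NeZero m] {w : Fin m → ℕ}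
    {V : Matrix (Fin m) (Fin m) (SkewPolynomial F)} {i : Fin m} :
    i ∈ walkIndices w V ↔ shiftedLeadPos (bumpShift w) (V i) = ((0 : Fin m) : WithBot (Fin m)) := by
  rw [walkIndices, List.mem_insertionSort, List.mem_filter]
  simp

theorem nodup_walkIndices [NeZero m] (w : Fin m → ℕ)
    (V : Matrix (Fin m) (Fin m) (SkewPolynomial F)) : (walkIndices w V).Nodup :=
  (List.perm_insertionSort _ _).nodup_iff.2 ((List.nodup_finRange m).filter _)

/-- The indices in the list are distinct, so each is charged at most once; their order plays no role
in the count. -/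
theorem ops_weakPopovWalk_le [NeZero m] (w : Fin m → ℕ)
    (V : Matrix (Fin m) (Fin m) (SkewPolynomial F)) (g : Fin m → ℕ)
    (hg : ∀ u ∈ walkIndices w V, ∀ i ∈ walkIndices w V, deg (V u 0) ≤ deg (V i 0) →
      2 + 3 * ∑ c, len (V u c) ≤ g i) : (weakPopovWalk w V).ops ≤ ∑ i, g i := by
  have hnd := nodup_walkIndices w V
  rw [weakPopovWalk]
  split
  · exact Nat.zero_le _
  · next t l hl =>
    rw [hl] at hnd hg
    have hnl : l.Nodup := (List.nodup_cons.1 hnd).2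
    change (l.foldlM walkLoop (V, t)).ops + 0 ≤ _
    rw [add_zero]
    refine (ops_foldlM_walkLoop_le V g l V t hnd (fun _ _ => rfl) hg).trans ?_
    rw [← List.sum_toFinset _ hnl]
    exact Finset.sum_le_sum_of_subset (Finset.subset_univ _)

/-- For the new shift the inequality is strict at every `c > 0`, and strictness absorbs the extra 1
at position 0. -/
theorem natDeg_add_le_of_shiftedLeadPos_bumpShift [NeZero m] {w : Fin m → ℕ}
    {v : Fin m → SkewPolynomial F}
    (hv : shiftedLeadPos (bumpShift w) v = ((0 : Fin m) : WithBot (Fin m))) :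
    v 0 ≠ 0 ∧ ∀ c, v c ≠ 0 → natDeg (v c) + w c ≤ natDeg (v 0) + w 0 := by
  obtain ⟨h0, -, h2⟩ := shiftedLeadPos_eq_coe hv
  refine ⟨h0, fun c hc => ?_⟩
  rcases eq_or_ne c 0 with rfl | hc0
  · exact le_rfl
  · have := h2 c hc (lt_of_le_of_ne (Fin.zero_le c) hc0.symm)
    simp only [bumpShift, Pi.add_apply, Pi.single_eq_same, Pi.single_eq_of_ne hc0] at this
    omega

theorem sum_sum_abs_sub_eq (w : Fin m → ℤ) :
    ∑ i, ∑ j, |w i - w j| = 2 * ∑ i, ∑ j ∈ Finset.Ioi i, |w i - w j| := by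
  have hsplit : ∀ i, ∑ j, |w i - w j| =
      ∑ j ∈ Finset.Ioi i, |w i - w j| + ∑ j ∈ Finset.Iio i, |w i - w j| := by
    intro i
    have : (Finset.univ : Finset (Fin m)) = insert i (Finset.Ioi i ∪ Finset.Iio i) := by
      ext j
      simp only [Finset.mem_univ, Finset.mem_insert, Finset.mem_union, Finset.mem_Ioi,
        Finset.mem_Iio, true_iff]
      rcases lt_trichotomy i j with h | h | h <;> simp [h]
    rw [this, Finset.sum_insert (by simp), sub_self, abs_zero, zero_add, Finset.sum_union]
    exact Finset.disjoint_left.2 fun j h1 h2 =>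
      lt_asymm (Finset.mem_Ioi.1 h1) (Finset.mem_Iio.1 h2)
  have hswap : ∑ i, ∑ j ∈ Finset.Iio i, |w i - w j| = ∑ i, ∑ j ∈ Finset.Ioi i, |w i - w j| := by
    rw [Finset.sum_comm' (t' := Finset.univ) (s' := fun j => Finset.Ioi j) (by simp)]
    exact Finset.sum_congr rfl fun i _ => Finset.sum_congr rfl fun j _ => abs_sub_comm _ _
  rw [Finset.sum_congr rfl fun i _ => hsplit i, Finset.sum_add_distrib, hswap, two_mul]

end Cost
end WeakPopov
end

theorem mainTheorem10 :
    ∃ C : ℕ, ∀ (F : Type*) [Field F] [Finite F] [MulSemiringAction (Multiplicative ℕ) F]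
      (m : ℕ) [NeZero m] (w : Fin m → ℕ) (V : Matrix (Fin m) (Fin m) (SkewPolynomial F)) (d : ℕ),
      WeakPopov.IsShiftedWeakPopov w V →
      WeakPopov.degDet V = (d : WithBot ℕ) →
      ((WeakPopov.weakPopovWalk w V).ops : ℤ) ≤
        C * (m * d + ∑ i : Fin m, ∑ j ∈ Finset.Ioi i, |(w i : ℤ) - (w j : ℤ)| + (m : ℤ) ^ 2) := by
  refine ⟨6, fun F _ _ _ m _ w V d hV hd => ?_⟩
  have hrow := WeakPopov.row_ne_zero_of_degDet_eq_coe hd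
  choose h hh using fun i => WeakPopov.exists_leadPos_eq
    (WeakPopov.shiftVec_ne_zero (w := w) (hrow i))
  have hinj : Function.Injective h := fun i j hij =>
    hV i j (WeakPopov.shiftVec_ne_zero (hrow i)) (WeakPopov.shiftVec_ne_zero (hrow j))
      ((hh i).trans ((congrArg _ hij).trans (hh j).symm))
  have hdeg := WeakPopov.sum_natDeg_le_degDet hinj hh hd
  -- The charge to `i`: the bound `deg v_{i,h_i} + w_{h_i} - w_c` on the degree of the entry at `c`,
  -- with the difference replaced by its absolute value, plus 1 to pass from degree to length.
  have hops := WeakPopov.ops_weakPopovWalk_le w V (fun i => 2 + 3 * ∑ c,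
    (WeakPopov.natDeg (V i (h i)) + ((w (h i) : ℤ) - w c).natAbs + 1)) (by
      intro u hu i hi hui
      obtain ⟨hu0, hu1⟩ := WeakPopov.natDeg_add_le_of_shiftedLeadPos_bumpShift
        (WeakPopov.mem_walkIndices.1 hu)
      obtain ⟨hi0, -⟩ := WeakPopov.natDeg_add_le_of_shiftedLeadPos_bumpShift
        (WeakPopov.mem_walkIndices.1 hi)
      rw [WeakPopov.deg_eq_natDeg hu0, WeakPopov.deg_eq_natDeg hi0] at hui
      have hui' := WithBot.coe_le_coe.1 hui
      have hi2 := (WeakPopov.shiftedLeadPos_eq_coe (hh i)).2.1 0 hi0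
      gcongr with c
      -- A zero entry has length 0 and costs nothing; the degree bounds speak of nonzero entries
      -- only.
      by_cases hc : V u c = 0
      · rw [hc, WeakPopov.len_zero]
        exact Nat.zero_le _
      · have h1 := hu1 c hc
        have h2 := WeakPopov.len_le (V u c)
        simp only [Nat.cast_id] at hui'
        omega)
  have hsum : ∑ i, ∑ c, |(w (h i) : ℤ) - w c| =
      2 * ∑ i : Fin m, ∑ j ∈ Finset.Ioi i, |(w i : ℤ) - (w j : ℤ)| := by
    rw [← WeakPopov.sum_sum_abs_sub_eq fun i => (w i : ℤ)]
    exact (Finite.injective_iff_bijective.1 hinj).sum_comp fun k => ∑ c, |(w k : ℤ) - w c|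
  have hS : 0 ≤ ∑ i : Fin m, ∑ j ∈ Finset.Ioi i, |(w i : ℤ) - (w j : ℤ)| :=
    Finset.sum_nonneg fun i _ => Finset.sum_nonneg fun j _ => abs_nonneg _
  have hm : (1 : ℤ) ≤ m := by exact_mod_cast NeZero.one_le
  have hops' : ((WeakPopov.weakPopovWalk w V).ops : ℤ) ≤ 2 * m + 3 * (
      m * ∑ i, (WeakPopov.natDeg (V i (h i)) : ℤ) + ∑ i, ∑ c, |(w (h i) : ℤ) - w c| + m * m) := by
    refine (Int.ofNat_le.2 hops).trans (le_of_eq ?_)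
    push_cast
    simp only [Finset.sum_add_distrib, ← Finset.mul_sum, Finset.sum_const, Finset.card_univ,
      Fintype.card_fin, nsmul_eq_mul, mul_one]
    ring
  have hdeg' : ∑ i, (WeakPopov.natDeg (V i (h i)) : ℤ) ≤ d := by exact_mod_cast hdeg
  rw [hsum] at hops'
  push_cast
  -- The total is at most `3md + 6S + 3m^2 + 2m`, with `S` the sum over `i < j`, and `2m ≤ 2m^2`.
  -- The coefficient of `S` dictates the constant 6.
  nlinarith [mul_le_mul_of_nonneg_left hdeg' (by omega : (0 : ℤ) ≤ m)]
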